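/- Let $\mathcal A$ be a locally small accessible category which has all (small) directed colimits, and let $\mathsf S(\mathcal A)=\mathrm{Acc}_\omega(\mathcal A,\mathbf{Set})$ be the category of all functors $\mathcal A\to\mathbf{Set}$ that preserve directed colimits, with all natural transformations as morphisms. A \emph{Scott topos} is a category $\mathcal G$ equivalent to $\mathsf S(\mathcal A)$ for some such $\mathcal A$. **Theorem.** Every Scott topos $\mathcal G\simeq\mathsf S(\mathcal A)$ is a Grothendieck topos (that is, equivalent to the category of sheaves of sets on a small site) and has enough points: the inverse image functors $p^*:\mathcal G\to\mathbf{Set}$ of all points $p$ of $\mathcal G$ are jointly conservative, i.e. a morphism $f$ of $\mathcal G$ is an isomorphism as soon as $p^*(f)$ is a bijection for every point $p$. Here a point of $\mathcal G$ is a geometric morphism $p:\mathbf{Set}\to\mathcal G$, i.e. an adjunction $p^*\dashv p_*$ with $p_*:\mathbf{Set}\to\mathcal G$ in which $p^*$ preserves finite limits. -/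

import Mathlib

open CategoryTheory CategoryTheory.Limits

universe w v₁ v₂ u₁ u₂ u

namespace ScottTopos

/-- The property of functors `A ⥤ Set` of preserving directed (equivalently, filtered)
`w`-small colimits; here `Set` is the category `Type w`. -/
def preservesDirectedColimits (A : Type u) [Category.{w} A] :
    ObjectProperty (A ⥤ Type w) :=
  fun F => PreservesFilteredColimitsOfSize.{w, w} F

/-- The category `S(A) = Acc_ω(A, Set)`: the full subcategory of `A ⥤ Set` on the functors
that preserve directed colimits. -/
abbrev Scott (A : Type u) [Category.{w} A] : Type (max u (w + 1)) :=
  (preservesDirectedColimits A).FullSubcategory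

/-- A geometric morphism `ℱ → ℰ`: an adjunction `f^* ⊣ f_*`, with `f_* : ℱ ⥤ ℰ`, whose
left adjoint `f^*` preserves finite limits. -/
structure GeometricMorphism (ℱ : Type u₁) [Category.{v₁} ℱ] (ℰ : Type u₂) [Category.{v₂} ℰ] where
  /-- The inverse image functor `f^*`. -/
  inverseImage : ℰ ⥤ ℱ
  /-- The direct image functor `f_*`. -/
  directImage : ℱ ⥤ ℰ
  /-- The adjunction `f^* ⊣ f_*`. -/
  adj : inverseImage ⊣ directImage
  /-- The inverse image functor is left exact. -/
  lex : PreservesFiniteLimits inverseImage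

/-- A point of `ℰ` is a geometric morphism `Set → ℰ`. -/
abbrev Point (ℰ : Type u₁) [Category.{v₁} ℰ] : Type (max u₁ v₁ (w + 1)) :=
  GeometricMorphism (Type w) ℰ

/-- A Grothendieck topos (relative to the universe `w`) is a category equivalent to the
category of sheaves of sets on a small site. -/
def IsGrothendieckTopos (ℰ : Type u₁) [Category.{v₁} ℰ] : Prop :=
  ∃ (C : Type w) (_ : SmallCategory C) (J : GrothendieckTopology C),
    Nonempty (ℰ ≌ Sheaf J (Type w))

/-- `ℰ` has enough points if the inverse image functors of all its points are jointly
conservative. -/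
def HasEnoughPoints (ℰ : Type u₁) [Category.{v₁} ℰ] : Prop :=
  ∀ ⦃X Y : ℰ⦄ (f : X ⟶ Y),
    (∀ p : Point.{w} ℰ, IsIso (p.inverseImage.map f)) → IsIso f

end ScottTopos

/-! Let `A` be `κ`-accessible and `C` a small model of its `κ`-presentable objects. Every object of
`A` is a filtered colimit of objects of `C`, so a functor preserving such colimits is the left Kan
extension of its restriction to `C`. Hence the evaluations at objects of `C` are jointly
conservative on `Scott A`. They preserve small colimits and finite limits, which are computed
pointwise because they commute with filtered colimits.

The main point is a small set of generators. Given `x ∈ F(c)`, lift elements repeatedly along maps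
from objects of `C` to filtered colimits of at most `κ`-sized diagrams in `C`. The elements reached
generate a subfunctor of `F` that contains `x`, preserves filtered colimits
(`preservesFilteredColimits_closure`) and has size bounded independently of `F` and `x`
(`exists_injective_closure`). Up to isomorphism there is only a small set of these.

A form of Giraud's theorem concludes. The generators form a site whose covering sieves are those
that the evaluations see as jointly surjective. Both the given category and the sheaves are the
localization of presheaves at the maps inverted by the evaluations (`nonempty_equivalence_sheaf`).
-/

namespace ScottTopos

/-! ### Giraud's theorem in the presence of a conservative family of points. -/

section Giraud

universe u' i

open Opposite

section Fiber

variable {D : Type w} [SmallCategory D] {E : Type u'} [Category.{w} E] [HasFiniteLimits E]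
  (ι : D ⥤ E) (q : E ⥤ Type w) [PreservesFiniteLimits q]

/-- Every element of `q.obj X` comes from an element of `q.obj (ι.obj d)` along some
morphism `ι.obj d ⟶ X`. -/
def Covers : Prop :=
  ∀ ⦃X : E⦄ (x : q.obj X), ∃ (d : D) (a : ι.obj d ⟶ X) (z : q.obj (ι.obj d)), q.map a z = x

variable {ι q}

/-- `D` need not have pullbacks: the pullback is formed in `E`, preserved by `q`, then covered by an
object of `D`. -/
lemma Covers.exists_pullback (h : Covers ι q) {X Y Z : E} (f : X ⟶ Z) (g : Y ⟶ Z)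
    (x : q.obj X) (y : q.obj Y) (hxy : q.map f x = q.map g y) :
    ∃ (d : D) (a : ι.obj d ⟶ X) (b : ι.obj d ⟶ Y) (z : q.obj (ι.obj d)),
      a ≫ f = b ≫ g ∧ q.map a z = x ∧ q.map b z = y := by
  have hp := (IsPullback.of_hasPullback f g).map q
  obtain ⟨t, ht₁, ht₂⟩ := Types.exists_of_isPullback hp x y hxy
  obtain ⟨d, a, z, hz⟩ := h t
  refine ⟨d, a ≫ pullback.fst f g, a ≫ pullback.snd f g, z, ?_, ?_, ?_⟩
  · simp [pullback.condition]
  · simp [hz, ht₁]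
  · simp [hz, ht₂]

lemma Covers.exists_prod (h : Covers ι q) {X Y : E} (x : q.obj X) (y : q.obj Y) :
    ∃ (d : D) (a : ι.obj d ⟶ X) (b : ι.obj d ⟶ Y) (z : q.obj (ι.obj d)),
      q.map a z = x ∧ q.map b z = y := by
  have hT : IsTerminal (q.obj (⊤_ E)) := IsTerminal.isTerminalObj q _ terminalIsTerminal
  obtain ⟨d, a, b, z, -, h₁, h₂⟩ := h.exists_pullback (terminal.from X) (terminal.from Y) x y
    (((Types.isTerminalEquivUnique _).1 hT).instSubsingleton.elim _ _)
  exact ⟨d, a, b, z, h₁, h₂⟩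

lemma Covers.exists_equalizer (h : Covers ι q) {X Y : E} (f g : X ⟶ Y)
    (x : q.obj X) (hx : q.map f x = q.map g x) :
    ∃ (d : D) (a : ι.obj d ⟶ X) (z : q.obj (ι.obj d)), a ≫ f = a ≫ g ∧ q.map a z = x := by
  obtain ⟨t, ht, -⟩ := (Types.type_equalizer_iff_unique (q.map (equalizer.ι f g))
    (g := q.map f) (h := q.map g)
    (by simp only [← Functor.map_comp, equalizer.condition f g])).1
    ⟨isLimitForkMapOfIsLimit q _ (equalizerIsEqualizer f g)⟩ x hx
  obtain ⟨d, a, z, hz⟩ := h t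
  exact ⟨d, a ≫ equalizer.ι f g, z, by simp [equalizer.condition f g], by simp [hz, ht]⟩

lemma Covers.isCofiltered_elements [ι.Full] [ι.Faithful] (h : Covers ι q) :
    IsCofiltered (ι ⋙ q).Elements := by
  have hT : IsTerminal (q.obj (⊤_ E)) := IsTerminal.isTerminalObj q _ terminalIsTerminal
  have : Nonempty (ι ⋙ q).Elements := by
    obtain ⟨d, -, z, -⟩ := h ((Types.isTerminalEquivUnique _).1 hT).default
    exact ⟨⟨d, z⟩⟩
  refine { cone_objs := ?_, cone_maps := ?_ }
  · rintro ⟨d₁, z₁⟩ ⟨d₂, z₂⟩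
    obtain ⟨d, a, b, z, h₁, h₂⟩ := h.exists_prod (X := ι.obj d₁) (Y := ι.obj d₂) z₁ z₂
    exact ⟨⟨d, z⟩, ⟨ι.preimage a, by simpa using h₁⟩, ⟨ι.preimage b, by simpa using h₂⟩, trivial⟩
  · rintro ⟨d₁, z₁⟩ ⟨d₂, z₂⟩ ⟨f, hf⟩ ⟨g, hg⟩
    obtain ⟨d, a, z, h₁, h₂⟩ := h.exists_equalizer (ι.map f) (ι.map g) z₁ (hf.trans hg.symm)
    exact ⟨⟨d, z⟩, ⟨ι.preimage a, by simpa using h₂⟩, by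
      refine CategoryOfElements.ext _ _ _ (ι.map_injective ?_)
      change ι.map (ι.preimage a ≫ f) = ι.map (ι.preimage a ≫ g)
      simpa using h₁⟩

-- The extension at `P` is a colimit of objects `ι.obj d` indexed by the elements of `P`, and `q`
-- preserves it.
omit [HasFiniteLimits E] [PreservesFiniteLimits q] in
lemma exists_map_leftKanExtension_eq [HasColimitsOfSize.{w, w} E]
    [PreservesColimitsOfSize.{w, w} q] (P : Dᵒᵖ ⥤ Type w)
    (t : q.obj ((uliftYoneda.{w}.leftKanExtension ι).obj P)) :
    ∃ (d : D) (x : P.obj (op d)) (z : q.obj (ι.obj d)),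
      q.map ((uliftYoneda.{w}.leftKanExtensionUnit ι).app d ≫
        (uliftYoneda.{w}.leftKanExtension ι).map (uliftYonedaEquiv.symm x)) z = t := by
  have hc := isColimitOfPreserves q (Functor.isPointwiseLeftKanExtensionOfIsLeftKanExtension _
    (uliftYoneda.{w}.leftKanExtensionUnit ι) P)
  obtain ⟨j, z, hz⟩ := Types.jointly_surjective_of_isColimit hc t
  refine ⟨j.left, uliftYonedaEquiv j.hom, z, ?_⟩
  rw [Equiv.symm_apply_apply]
  exact hz

end Fiber

section Site

variable {D : Type w} [SmallCategory D] {E : Type u'} [Category.{w} E] [HasFiniteLimits E]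
  {ι : D ⥤ E} [ι.Full] [ι.Faithful] {I : Type i} {p : I → E ⥤ Type w}
  [∀ i, PreservesFiniteLimits (p i)] (hp : ∀ i, Covers ι (p i))

/-- The topology on `D` whose covering sieves are those which are jointly surjective
after applying the functors `p i`. -/
def coveringTopology : GrothendieckTopology D where
  sieves d := {S | ∀ (i : I) (z : (p i).obj (ι.obj d)), ∃ (d' : D) (g : d' ⟶ d) (_ : S g)
    (y : (p i).obj (ι.obj d')), (p i).map (ι.map g) y = z}
  top_mem' d i z := ⟨d, 𝟙 d, trivial, z, by simp⟩
  pullback_stable' d d' S h hS i z := by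
    obtain ⟨d₁, g, hg, y, hy⟩ := hS i ((p i).map (ι.map h) z)
    obtain ⟨d₂, a, b, t, h₁, h₂, h₃⟩ :=
      (hp i).exists_pullback (ι.map h) (ι.map g) z y hy.symm
    refine ⟨d₂, ι.preimage a, ?_, t, by simpa using h₂⟩
    have : ι.preimage a ≫ h = ι.preimage b ≫ g := ι.map_injective (by simpa using h₁)
    change S _
    rw [this]
    exact S.downward_closed hg _
  transitive' d S hS R hR i z := by
    obtain ⟨d₁, g, hg, y, rfl⟩ := hS i z
    obtain ⟨d₂, g', hg', y', rfl⟩ := hR hg i y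
    exact ⟨d₂, g' ≫ g, hg', y', by simp⟩

/-- The point of `D` given by the functor `p i`. -/
def fiberPoint (i : I) : (coveringTopology hp).Point where
  fiber := ι ⋙ p i
  isCofiltered := (hp i).isCofiltered_elements
  initiallySmall := initiallySmall_of_essentiallySmall _
  jointly_surjective _ h x := h i x

lemma isConservativeFamilyOfPoints :
    (ObjectProperty.ofObj (fiberPoint hp)).IsConservativeFamilyOfPoints :=
  .mk' (fun _ _ h i z ↦ h ⟨fiberPoint hp i, ⟨i⟩⟩ z)

lemma coveringTopology_W_iff {P Q : Dᵒᵖ ⥤ Type w} (f : P ⟶ Q) :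
    (coveringTopology hp).W f ↔ ∀ i, IsIso ((fiberPoint hp i).presheafFiber.map f) := by
  rw [(isConservativeFamilyOfPoints hp).W_iff]
  exact ⟨fun h i ↦ h ⟨_, ⟨i⟩⟩, by rintro h ⟨_, ⟨i⟩⟩; exact h i⟩

variable [HasColimitsOfSize.{w, w} E] [∀ i, PreservesColimitsOfSize.{w, w} (p i)]

/-- The extension of `ι ⋙ p i` to presheaves is the fiber functor of the corresponding point. -/
noncomputable def leftKanExtensionCompIso (i : I) :
    uliftYoneda.{w}.leftKanExtension ι ⋙ p i ≅ (fiberPoint hp i).presheafFiber :=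
  Presheaf.uniqueExtensionAlongULiftYoneda.{w} (A := ι ⋙ p i) _
    (Functor.isoWhiskerRight (Presheaf.isExtensionAlongULiftYoneda.{w} ι).symm (p i) ≪≫
      Functor.associator _ _ _) ≪≫
  (Presheaf.uniqueExtensionAlongULiftYoneda.{w} (A := ι ⋙ p i) _
    ((fiberPoint hp i).shrinkYonedaCompPresheafFiberIso.symm ≪≫
      Functor.isoWhiskerRight uliftYonedaIsoShrinkYoneda.{w}.symm _)).symm

variable (hiso : ∀ ⦃X Y : E⦄ (f : X ⟶ Y), (∀ i, IsIso ((p i).map f)) → IsIso f)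

-- The source of the counit is the colimit of the `ι.obj d` over all maps `ι.obj d ⟶ X`. After
-- applying `p i`, surjectivity is `Covers`, and injectivity follows by covering the pullback of two
-- such maps.
omit [ι.Faithful] in
include hp hiso in
lemma isIso_counit (X : E) :
    IsIso ((Presheaf.uliftYonedaAdjunction.{w} _
      (uliftYoneda.{w}.leftKanExtensionUnit ι)).counit.app X) := by
  let L := uliftYoneda.{w}.leftKanExtension ι
  let α := uliftYoneda.{w}.leftKanExtensionUnit ι
  let N := Presheaf.restrictedULiftYoneda.{w} ι
  let adj := Presheaf.uliftYonedaAdjunction.{w} L α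
  -- The colimit leg indexed by `f`.
  let j {d : D} (f : ι.obj d ⟶ X) : ι.obj d ⟶ L.obj (N.obj X) :=
    α.app d ≫ L.map ((uliftYonedaEquiv (X := d) (F := N.obj X)).symm (ULift.up f))
  have hj {d : D} (f : ι.obj d ⟶ X) : j f ≫ adj.counit.app X = f := by
    have h := Presheaf.uliftYonedaAdjunction_homEquiv_app.{w} L α (adj.counit.app X)
      (Z := op d) (ULift.up f)
    rw [show (Presheaf.uliftYonedaAdjunction.{w} L α).homEquiv _ _ (adj.counit.app X) = 𝟙 _ from
      adj.right_triangle_components X] at h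
    exact (Category.assoc _ _ _).trans (congr_arg ULift.down h.symm)
  have hj' {d d' : D} (g : d' ⟶ d) (f : ι.obj d ⟶ X) : ι.map g ≫ j f = j (ι.map g ≫ f) := by
    have h₁ := α.naturality g
    dsimp at h₁
    simp only [j]
    rw [reassoc_of% h₁, ← L.map_comp]
    exact congr_arg (fun k ↦ α.app d' ≫ L.map k)
      (uliftYonedaEquiv_symm_map (F := N.obj X) g.op (ULift.up f)).symm
  refine hiso _ fun i ↦ (isIso_iff_bijective _).2 ⟨fun t₁ t₂ h ↦ ?_, fun x ↦ ?_⟩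
  · obtain ⟨d₁, ⟨f₁⟩, z₁, rfl⟩ := exists_map_leftKanExtension_eq (q := p i) _ t₁
    obtain ⟨d₂, ⟨f₂⟩, z₂, rfl⟩ := exists_map_leftKanExtension_eq (q := p i) _ t₂
    change (p i).map (adj.counit.app X) ((p i).map (j f₁) z₁) =
      (p i).map (adj.counit.app X) ((p i).map (j f₂) z₂) at h
    rw [← Functor.map_comp_apply, ← Functor.map_comp_apply, hj, hj] at h
    obtain ⟨d, a, b, z, h₁, rfl, rfl⟩ := (hp i).exists_pullback f₁ f₂ z₁ z₂ h
    change (p i).map (j f₁) ((p i).map a z) = (p i).map (j f₂) ((p i).map b z)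
    rw [← Functor.map_comp_apply, ← Functor.map_comp_apply, ← ι.map_preimage a,
      ← ι.map_preimage b, hj', hj', ι.map_preimage, ι.map_preimage, h₁]
  · obtain ⟨d, a, z, rfl⟩ := hp i x
    refine ⟨(p i).map (j a) z, ?_⟩
    change (p i).map (adj.counit.app X) _ = _
    rw [← Functor.map_comp_apply, hj]

-- A left adjoint with fully faithful right adjoint is a localization at the maps it inverts. Here
-- these are the maps that sheafification inverts, and localizations are unique.
include hp hiso in
lemma nonempty_equivalence_sheaf : Nonempty (E ≌ Sheaf (coveringTopology hp) (Type w)) := by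
  let L := uliftYoneda.{w}.leftKanExtension ι
  let adj := Presheaf.uliftYonedaAdjunction.{w} L (uliftYoneda.{w}.leftKanExtensionUnit ι)
  have := isIso_counit hp hiso
  have : IsIso adj.counit := NatIso.isIso_of_isIso_app _
  have := adj.fullyFaithfulROfIsIsoCounit.full
  have := adj.fullyFaithfulROfIsIsoCounit.faithful
  have hW : (coveringTopology hp).W = (MorphismProperty.isomorphisms E).inverseImage L := by
    ext P Q f
    rw [coveringTopology_W_iff]
    have h (i : I) : IsIso ((fiberPoint hp i).presheafFiber.map f) ↔
        IsIso ((p i).map (L.map f)) :=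
      (NatIso.isIso_map_iff (leftKanExtensionCompIso hp i) f).symm
    simp only [h]
    exact ⟨fun h ↦ hiso _ h, fun (h : IsIso (L.map f)) i ↦ inferInstance⟩
  have : L.IsLocalization (coveringTopology hp).W := hW ▸ adj.isLocalization
  exact ⟨Localization.uniq L (presheafToSheaf _ _) (coveringTopology hp).W⟩

end Site

section Transfer

variable {D : Type w} [SmallCategory D] {J : GrothendieckTopology D}
  {𝒢 : Type u₁} [Category.{v₁} 𝒢]

/-- A point of a site `(D, J)` induces a point of any category equivalent to sheaves
on `(D, J)`. -/
noncomputable def pointOfEquivalence (e : 𝒢 ≌ Sheaf J (Type w)) (Φ : GrothendieckTopology.Point.{w} J) :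
    Point.{w} 𝒢 where
  inverseImage := e.functor ⋙ Φ.sheafFiber
  directImage := Φ.skyscraperSheafFunctor ⋙ e.inverse
  adj := e.toAdjunction.comp Φ.skyscraperSheafAdjunction
  lex := inferInstance

lemma hasEnoughPoints_of_equivalence (e : 𝒢 ≌ Sheaf J (Type w))
    {P : ObjectProperty (GrothendieckTopology.Point.{w} J)} (hP : P.IsConservativeFamilyOfPoints) :
    HasEnoughPoints.{w} 𝒢 := by
  intro X Y f h
  have h' (Φ : P.FullSubcategory) : IsIso (Φ.obj.sheafFiber.map (e.functor.map f)) :=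
    h (pointOfEquivalence e Φ.obj)
  have := hP.jointlyReflectIsomorphisms_type.isIso (e.functor.map f)
  exact isIso_of_reflects_iso f e.functor

end Transfer

/-- Giraud's theorem for categories with enough points. -/
theorem isGrothendieckTopos_and_hasEnoughPoints
    {D : Type w} [SmallCategory D] {E : Type u'} [Category.{w} E] [HasFiniteLimits E]
    [HasColimitsOfSize.{w, w} E] (ι : D ⥤ E) [ι.Full] [ι.Faithful]
    {I : Type i} (p : I → E ⥤ Type w) [∀ i, PreservesFiniteLimits (p i)]
    [∀ i, PreservesColimitsOfSize.{w, w} (p i)] (hp : ∀ i, Covers ι (p i))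
    (hiso : ∀ ⦃X Y : E⦄ (f : X ⟶ Y), (∀ i, IsIso ((p i).map f)) → IsIso f)
    {𝒢 : Type u₁} [Category.{v₁} 𝒢] (e : 𝒢 ≌ E) :
    IsGrothendieckTopos.{w} 𝒢 ∧ HasEnoughPoints.{w} 𝒢 := by
  obtain ⟨e'⟩ := nonempty_equivalence_sheaf hp hiso
  exact ⟨⟨D, _, coveringTopology hp, ⟨e.trans e'⟩⟩,
    hasEnoughPoints_of_equivalence (e.trans e') (isConservativeFamilyOfPoints hp)⟩

end Giraud
-- Directed colimits as highly filtered colimits of small directed colimits.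
section DirectedSubsets

variable {α : Type w} [Preorder α] {κ : Cardinal.{w}}

lemma exists_directedOn_superset [IsDirectedOrder α] [Fact κ.IsRegular]
    (hκ : Cardinal.aleph0 < κ) (U : Set α) (hU : HasCardinalLT U κ) :
    ∃ V : Set α, U ⊆ V ∧ DirectedOn (· ≤ ·) V ∧ HasCardinalLT V κ := by
  choose ub hub₁ hub₂ using fun a b : α ↦ exists_ge_ge a b
  -- Adjoin chosen upper bounds of pairs `ω` times; the countable union stays below `κ` because `κ`
  -- is regular and uncountable.
  let W (n : ℕ) : Set α := Nat.rec U (fun _ W ↦ W ∪ Set.image2 ub W W) n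
  have hW (n : ℕ) : W (n + 1) = W n ∪ Set.image2 ub (W n) (W n) := rfl
  have hmono : Monotone W := monotone_nat_of_le_succ fun n ↦ by
    rw [hW]; exact Set.subset_union_left
  refine ⟨⋃ n, W n, Set.subset_iUnion W 0, ?_, hasCardinalLT_iUnion _ ?_ fun n ↦ ?_⟩
  · rintro x hx y hy
    obtain ⟨m, hm⟩ := Set.mem_iUnion.1 hx
    obtain ⟨n, hn⟩ := Set.mem_iUnion.1 hy
    refine ⟨ub x y, Set.mem_iUnion.2 ⟨max m n + 1, ?_⟩, hub₁ x y, hub₂ x y⟩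
    rw [hW]
    exact Or.inr (Set.mem_image2_of_mem (hmono (le_max_left m n) hm) (hmono (le_max_right m n) hn))
  · simpa [HasCardinalLT] using hκ
  · induction n with
    | zero => exact hU
    | succ n hn =>
      rw [hW]
      refine hasCardinalLT_union hκ.le hn ?_
      let φ (x : ↥(W n) × ↥(W n)) : ↥(Set.image2 ub (W n) (W n)) :=
        ⟨ub x.1.1 x.2.1, Set.mem_image2_of_mem x.1.2 x.2.2⟩
      refine (hasCardinalLT_prod hκ.le hn hn).of_surjective φ ?_
      rintro ⟨_, x, hx, y, hy, rfl⟩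
      exact ⟨⟨⟨x, hx⟩, ⟨y, hy⟩⟩, rfl⟩

variable (α κ) in
/-- The poset of nonempty directed subsets of `α` of cardinality `< κ`. -/
abbrev DirectedSubset : Type w :=
  {U : Set α // U.Nonempty ∧ DirectedOn (· ≤ ·) U ∧ HasCardinalLT U κ}

namespace DirectedSubset

variable (U : DirectedSubset α κ)

instance : Nonempty U.1 := U.2.1.to_subtype

instance : IsDirectedOrder U.1 := directedOn_iff_isDirectedOrder.1 U.2.2.1

lemma hasCardinalLT_arrow (hκ : Cardinal.aleph0 ≤ κ) : HasCardinalLT (Arrow U.1) κ :=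
  (hasCardinalLT_prod hκ U.2.2.2 U.2.2.2).of_injective (fun f ↦ (f.left, f.right)) (by
    rintro ⟨a, b, f⟩ ⟨a', b', f'⟩ h
    obtain ⟨h₁, h₂⟩ := Prod.mk.inj h
    change a = a' at h₁
    change b = b' at h₂
    subst h₁ h₂
    exact congr_arg Arrow.mk (Subsingleton.elim f f'))

/-- The inclusion functor of a directed subset. -/
abbrev incl : U.1 ⥤ α := (Subtype.mono_coe (· ∈ U.1)).functor

variable (κ) in
/-- A singleton, as a directed subset. -/
def singleton (hκ : Cardinal.aleph0 ≤ κ) (a : α) : DirectedSubset α κ :=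
  ⟨{a}, Set.singleton_nonempty a, directedOn_singleton a, hasCardinalLT_of_finite _ _ hκ⟩

variable (κ) in
/-- A pair of comparable elements, as a directed subset. -/
def pair (hκ : Cardinal.aleph0 ≤ κ) {a b : α} (h : a ≤ b) : DirectedSubset α κ :=
  ⟨{a, b}, Set.insert_nonempty _ _, directedOn_pair h, hasCardinalLT_of_finite _ _ hκ⟩

lemma isCardinalFiltered [IsDirectedOrder α] [Nonempty α] [Fact κ.IsRegular]
    (hκ : Cardinal.aleph0 < κ) : IsCardinalFiltered (DirectedSubset α κ) κ :=
  isCardinalFiltered_preorder _ _ fun K s hK ↦ by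
    obtain ⟨V, hV, hV', hV''⟩ := exists_directedOn_superset hκ
      -- The extra point keeps the set nonempty when the family is empty.
      ((⋃ k, (s k).1) ∪ {Classical.arbitrary α})
      (hasCardinalLT_union hκ.le (hasCardinalLT_iUnion _
        ((hasCardinalLT_iff_cardinal_mk_lt _ _).2 hK) (fun k ↦ (s k).2.2.2))
        (hasCardinalLT_of_finite _ _ hκ.le))
    exact ⟨⟨V, ⟨_, hV (Or.inr rfl)⟩, hV', hV''⟩,
      fun k ↦ (Set.subset_iUnion (fun k ↦ (s k).1) k).trans (Set.subset_union_left.trans hV)⟩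

section Colimits

variable {A : Type u} [Category.{w} A] [HasFilteredColimitsOfSize.{w, w} A] (D : α ⥤ A)

/-- The canonical map to the colimit over a directed subset. -/
noncomputable def toColimit (U : DirectedSubset α κ) {a : α} (ha : a ∈ U.1) :
    D.obj a ⟶ colimit (U.incl ⋙ D) :=
  colimit.ι (U.incl ⋙ D) ⟨a, ha⟩

lemma map_toColimit (U : DirectedSubset α κ) {a b : α} (h : a ≤ b) (ha : a ∈ U.1)
    (hb : b ∈ U.1) : D.map (homOfLE h) ≫ toColimit D U hb = toColimit D U ha :=
  colimit.w (U.incl ⋙ D) (homOfLE h : (⟨a, ha⟩ : U.1) ⟶ ⟨b, hb⟩)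

variable {D} in
lemma colimit_hom_ext {U : DirectedSubset α κ} {X : A} {f g : colimit (U.incl ⋙ D) ⟶ X}
    (h : ∀ (a : α) (ha : a ∈ U.1), toColimit D U ha ≫ f = toColimit D U ha ≫ g) : f = g :=
  colimit.hom_ext fun a ↦ h a.1 a.2

variable {D} in
/-- Constructor for morphisms from the colimit over a directed subset. -/
noncomputable def colimitDesc {U : DirectedSubset α κ} {X : A}
    (φ : ∀ (a : α), a ∈ U.1 → (D.obj a ⟶ X))
    (hφ : ∀ (a b : α) (h : a ≤ b) (ha : a ∈ U.1) (hb : b ∈ U.1),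
      D.map (homOfLE h) ≫ φ b hb = φ a ha) :
    colimit (U.incl ⋙ D) ⟶ X :=
  colimit.desc (U.incl ⋙ D)
    { pt := X
      ι :=
        { app a := φ a.1 a.2
          naturality a b f := (hφ a.1 b.1 (leOfHom f) a.2 b.2).trans (Category.comp_id _).symm } }

variable {D} in
@[simp]
lemma toColimit_colimitDesc {U : DirectedSubset α κ} {X : A}
    (φ : ∀ (a : α), a ∈ U.1 → (D.obj a ⟶ X))
    (hφ : ∀ (a b : α) (h : a ≤ b) (ha : a ∈ U.1) (hb : b ∈ U.1),
      D.map (homOfLE h) ≫ φ b hb = φ a ha) {a : α} (ha : a ∈ U.1) :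
    toColimit D U ha ≫ colimitDesc φ hφ = φ a ha :=
  colimit.ι_desc _ _

variable {D} in
@[simp]
lemma toColimit_colimitDesc_assoc {U : DirectedSubset α κ} {X Y : A}
    (φ : ∀ (a : α), a ∈ U.1 → (D.obj a ⟶ X))
    (hφ : ∀ (a b : α) (h : a ≤ b) (ha : a ∈ U.1) (hb : b ∈ U.1),
      D.map (homOfLE h) ≫ φ b hb = φ a ha) {a : α} (ha : a ∈ U.1) (g : X ⟶ Y) :
    toColimit D U ha ≫ colimitDesc φ hφ ≫ g = φ a ha ≫ g := by
  rw [← Category.assoc, toColimit_colimitDesc]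

/-- The functor sending a directed subset `U` of `α` to the colimit of the restriction
to `U` of a diagram indexed by `α`. -/
noncomputable def colimitFunctor : DirectedSubset α κ ⥤ A where
  obj U := colimit (U.incl ⋙ D)
  map {U V} h := colimitDesc (fun _ ha ↦ toColimit D V (leOfHom h ha))
    (fun _ _ h' _ _ ↦ map_toColimit D V h' _ _)
  map_id U := colimit_hom_ext fun a ha ↦ by
    rw [toColimit_colimitDesc, Category.comp_id]
  map_comp f g := colimit_hom_ext fun a ha ↦ by
    rw [toColimit_colimitDesc, toColimit_colimitDesc_assoc, toColimit_colimitDesc]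

lemma toColimit_colimitFunctor_map {U V : DirectedSubset α κ} (h : U ⟶ V) {a : α}
    (ha : a ∈ U.1) :
    toColimit D U ha ≫ (colimitFunctor D).map h = toColimit D V (leOfHom h ha) :=
  toColimit_colimitDesc (fun _ ha ↦ toColimit D V (leOfHom h ha))
    (fun _ _ h' _ _ ↦ map_toColimit D V h' _ _) ha

variable {D}

/-- The cocone over `colimitFunctor D` given by a cocone over `D`. -/
noncomputable def colimitCocone (s : Cocone D) : Cocone (colimitFunctor (κ := κ) D) where
  pt := s.pt
  ι :=
    { app U := colimitDesc (U := U) (fun a _ ↦ s.ι.app a) (fun _ _ h _ _ ↦ s.w (homOfLE h))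
      naturality U V h := colimit_hom_ext fun a ha ↦ by
        dsimp [colimitFunctor]
        rw [toColimit_colimitDesc_assoc, toColimit_colimitDesc, Category.comp_id,
          toColimit_colimitDesc] }

lemma toColimit_colimitCocone_ι_app (s : Cocone D) (U : DirectedSubset α κ) {a : α}
    (ha : a ∈ U.1) : toColimit D U ha ≫ (colimitCocone s).ι.app U = s.ι.app a :=
  toColimit_colimitDesc (U := U) (fun a _ ↦ s.ι.app a) (fun _ _ h _ _ ↦ s.w (homOfLE h)) ha

lemma toColimit_colimitCocone_ι_app_assoc (s : Cocone D) (U : DirectedSubset α κ) {a : α}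
    (ha : a ∈ U.1) {X : A} (g : s.pt ⟶ X) :
    toColimit D U ha ≫ (colimitCocone s).ι.app U ≫ g = s.ι.app a ≫ g :=
  (Category.assoc _ _ _).symm.trans
    (congr_arg (· ≫ g) (toColimit_colimitCocone_ι_app s U ha))

lemma toColimit_ι_app_eq (t : Cocone (colimitFunctor (κ := κ) D)) {U V : DirectedSubset α κ}
    (h : U ≤ V) {a : α} (ha : a ∈ U.1) :
    toColimit D U ha ≫ t.ι.app U = toColimit D V (h ha) ≫ t.ι.app V := by
  rw [← t.w (homOfLE h)]
  exact (Category.assoc _ _ _).symm.trans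
    (congr_arg (· ≫ t.ι.app V) (toColimit_colimitFunctor_map D (homOfLE h) ha))

/-- The colimit of `D` is the colimit of the colimits of the restrictions of `D` to small
directed subsets. -/
noncomputable def isColimitColimitCocone (hκ : Cardinal.aleph0 ≤ κ) {s : Cocone D}
    (hs : IsColimit s) : IsColimit (colimitCocone (κ := κ) s) where
  desc t := hs.desc
    { pt := t.pt
      ι :=
        { app a := toColimit D (singleton κ hκ a) rfl ≫ t.ι.app (singleton κ hκ a)
          naturality a b f := by
            -- The legs at `a ≤ b` are compared inside the directed subset `{a, b}`.
            have ha : singleton κ hκ a ≤ pair κ hκ (leOfHom f) := fun _ h ↦ Or.inl h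
            have hb : singleton κ hκ b ≤ pair κ hκ (leOfHom f) := fun _ h ↦ Or.inr h
            rw [toColimit_ι_app_eq t ha rfl, toColimit_ι_app_eq t hb rfl,
              ← map_toColimit D _ (leOfHom f) (ha rfl) (hb rfl)]
            exact (Category.assoc _ _ _).symm.trans (Category.comp_id _).symm } }
  fac t U := colimit_hom_ext fun a ha ↦ by
    have h : singleton κ hκ a ≤ U := by rintro _ rfl; exact ha
    exact (toColimit_colimitCocone_ι_app_assoc s U ha _).trans
      ((hs.fac _ a).trans (toColimit_ι_app_eq t h rfl))
  uniq t m hm := hs.hom_ext fun a ↦ by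
    rw [hs.fac]
    refine (toColimit_colimitCocone_ι_app_assoc s (singleton κ hκ a) rfl m).symm.trans ?_
    exact congr_arg (toColimit D (singleton κ hκ a) rfl ≫ ·) (hm _)

end Colimits

end DirectedSubset

/-- The poset of directed subsets of size `< κ'` is `κ'`-filtered, hence `κ`-filtered. Strictness of
`κ < κ'` makes `κ'` uncountable even if `κ = ℵ₀`. -/
lemma exists_directedSubset_factorization {A : Type u} [Category.{w} A]
    [HasFilteredColimitsOfSize.{w, w} A] [IsDirectedOrder α] [Nonempty α]
    {κ' : Cardinal.{w}} [Fact κ.IsRegular] [Fact κ'.IsRegular] (hκ : κ < κ') {D : α ⥤ A}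
    {s : Cocone D} (hs : IsColimit s) {X : A} [IsCardinalPresentable X κ] (f : X ⟶ s.pt) :
    ∃ (U : DirectedSubset α κ') (g : X ⟶ colimit (U.incl ⋙ D)),
      g ≫ colimit.desc (U.incl ⋙ D) (s.whisker U.incl) = f := by
  have hκ₀ : Cardinal.aleph0 ≤ κ := Cardinal.IsRegular.aleph0_le Fact.out
  have := DirectedSubset.isCardinalFiltered (α := α) (hκ₀.trans_lt hκ)
  have := IsCardinalFiltered.of_le (DirectedSubset α κ') hκ.le
  exact IsCardinalPresentable.exists_hom_of_isColimit κ
    (DirectedSubset.isColimitColimitCocone (hκ₀.trans hκ.le) hs) f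

end DirectedSubsets

/-! ### Refining a filtered diagram to one of objects of a dense subcategory. -/

section CommaDiagram

variable {C : Type w} [SmallCategory C] {A : Type u} [Category.{w} A] (ι : C ⥤ A)
  {I : Type w} [SmallCategory I] (a : I ⥤ A)

lemma isFiltered_comma [∀ X, IsFiltered (CostructuredArrow ι X)] [IsFiltered I] :
    IsFiltered (Comma ι a) := by
  have : Nonempty (Comma ι a) := by
    let i : I := Classical.choice IsFiltered.nonempty
    let X : CostructuredArrow ι (a.obj i) := Classical.choice IsFiltered.nonempty
    exact ⟨⟨X.left, i, X.hom⟩⟩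
  refine { cocone_objs := fun X Y ↦ ?_, cocone_maps := fun X Y f g ↦ ?_ }
  · let i := IsFiltered.max X.right Y.right
    let X' : CostructuredArrow ι (a.obj i) :=
      .mk (X.hom ≫ a.map (IsFiltered.leftToMax X.right Y.right))
    let Y' : CostructuredArrow ι (a.obj i) :=
      .mk (Y.hom ≫ a.map (IsFiltered.rightToMax X.right Y.right))
    refine ⟨⟨(IsFiltered.max X' Y').left, i, (IsFiltered.max X' Y').hom⟩,
      ⟨(IsFiltered.leftToMax X' Y').left, IsFiltered.leftToMax X.right Y.right, ?_⟩,
      ⟨(IsFiltered.rightToMax X' Y').left, IsFiltered.rightToMax X.right Y.right, ?_⟩, trivial⟩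
    · exact CostructuredArrow.w (IsFiltered.leftToMax X' Y')
    · exact CostructuredArrow.w (IsFiltered.rightToMax X' Y')
  · let h := IsFiltered.coeqHom f.right g.right
    let X' : CostructuredArrow ι (a.obj (IsFiltered.coeq f.right g.right)) :=
      .mk (X.hom ≫ a.map (f.right ≫ h))
    let Y' : CostructuredArrow ι (a.obj (IsFiltered.coeq f.right g.right)) :=
      .mk (Y.hom ≫ a.map h)
    let f' : X' ⟶ Y' := CostructuredArrow.homMk f.left (by simp [X', Y'])
    let g' : X' ⟶ Y' := CostructuredArrow.homMk g.left (by
      have : f.right ≫ h = g.right ≫ h := IsFiltered.coeq_condition f.right g.right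
      simp [X', Y', this])
    refine ⟨⟨(IsFiltered.coeq f' g').left, _, (IsFiltered.coeq f' g').hom⟩,
      ⟨(IsFiltered.coeqHom f' g').left, h, CostructuredArrow.w (IsFiltered.coeqHom f' g')⟩, ?_⟩
    ext
    · exact congr_arg (fun k : X' ⟶ _ ↦ k.left) (IsFiltered.coeq_condition f' g')
    · exact IsFiltered.coeq_condition f.right g.right

variable {a}

/-- The cocone over the diagram of all the objects of `C` over a diagram `a` that is given
by a cocone over `a`. -/
@[simps]
def commaCocone (s : Cocone a) : Cocone (Comma.fst ι a ⋙ ι) where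
  pt := s.pt
  ι :=
    { app X := X.hom ≫ s.ι.app X.right
      naturality X Y f := by
        have := s.w f.right
        simp [reassoc_of% f.w, this] }

variable [ι.IsDense]

lemma hom_ext_of_isDense {X Y : A} {f g : X ⟶ Y}
    (h : ∀ (c : C) (k : ι.obj c ⟶ X), k ≫ f = k ≫ g) : f = g :=
  (ι.denseAt X).hom_ext' fun c k ↦
    (Category.id_comp (k ≫ f)).trans ((h c k).trans (Category.id_comp (k ≫ g)).symm)

/-- A colimit of a diagram `a` is also the colimit of all the objects of `C` over `a`, when
`C` is dense. -/
noncomputable def isColimitCommaCocone {s : Cocone a} (hs : IsColimit s) :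
    IsColimit (commaCocone ι s) :=
  -- Density at `a.obj i` glues the part of `t` lying over `i` into one map.
  have key (t : Cocone (Comma.fst ι a ⋙ ι)) (i : I) : ∃ l : a.obj i ⟶ t.pt,
      ∀ (c : C) (k : ι.obj c ⟶ a.obj i), k ≫ l = t.ι.app ⟨c, i, k⟩ := by
    let c : Cocone (CostructuredArrow.proj ι (a.obj i) ⋙ ι) :=
      { pt := t.pt
        ι :=
          { app X := t.ι.app ⟨X.left, i, X.hom⟩
            naturality X Y f := by
              let f' : (⟨X.left, i, X.hom⟩ : Comma ι a) ⟶ ⟨Y.left, i, Y.hom⟩ :=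
                { left := f.left, right := 𝟙 i, w := by simp }
              exact (t.w f').trans (Category.comp_id _).symm } }
    exact ⟨(ι.denseAt (a.obj i)).desc c, fun d k ↦
      (congr_arg (· ≫ (ι.denseAt (a.obj i)).desc c) (Category.id_comp k)).symm.trans
        ((ι.denseAt (a.obj i)).fac c (.mk k))⟩
  { desc t := hs.desc
      { pt := t.pt
        ι :=
          { app i := (key t i).choose
            naturality i j f := hom_ext_of_isDense ι fun c k ↦ by
              let f' : (⟨c, i, k⟩ : Comma ι a) ⟶ ⟨c, j, k ≫ a.map f⟩ :=
                { left := 𝟙 c, right := f, w := by simp }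
              have h := t.w f'
              have h' : ι.map (𝟙 c) ≫ t.ι.app ⟨c, j, k ≫ a.map f⟩ = t.ι.app ⟨c, i, k⟩ := h
              dsimp
              rw [Category.comp_id, (key t i).choose_spec, ← h', ← Category.assoc,
                (key t j).choose_spec, ι.map_id, Category.id_comp] } }
    fac t X := by
      exact (Category.assoc _ _ _).trans ((congr_arg (X.hom ≫ ·) (hs.fac _ X.right)).trans
        ((key t X.right).choose_spec X.left X.hom))
    uniq t m hm := hs.hom_ext fun i ↦ hom_ext_of_isDense ι fun c k ↦ by
      rw [hs.fac]
      refine .trans ?_ ((key t i).choose_spec c k).symm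
      rw [← hm]
      exact (Category.assoc _ _ _).symm }

end CommaDiagram

/-! ### Factoring maps to filtered colimits through small filtered colimits of objects of `C`. -/

section FilteredFactorization

variable {C : Type w} [SmallCategory C] {A : Type u} [Category.{w} A]
  [HasFilteredColimitsOfSize.{w, w} A] (ι : C ⥤ A) (κ : Cardinal.{w})

/-- A morphism from `ι.obj c` to a filtered colimit of a diagram of size `< κ`
of objects of the form `ι.obj d`. -/
structure FilteredFactorization (c : C) : Type w where
  /-- The index category. -/
  J : SmallCategoryCardinalLT κ
  isFiltered : IsFiltered (SmallCategoryCardinalLT.categoryFamily κ J)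
  /-- The diagram. -/
  D : SmallCategoryCardinalLT.categoryFamily κ J ⥤ C
  /-- The morphism to the colimit of the diagram. -/
  hom : ι.obj c ⟶ colimit (D ⋙ ι)

attribute [instance] FilteredFactorization.isFiltered

variable {κ} [Fact κ.IsRegular] {κ' : Cardinal.{w}} [Fact κ'.IsRegular] [ι.IsDense]
  [∀ X, IsFiltered (CostructuredArrow ι X)]

/-- The refined diagram has the same colimit, and `f` factors through a small directed piece of it.
Each vertex of that piece comes with a map to some `a.obj i`, whence the last clause. -/
lemma exists_filteredFactorization (hκ : κ < κ') {I : Type w} [SmallCategory I] [IsFiltered I]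
    {a : I ⥤ A} {s : Cocone a} (hs : IsColimit s) {c : C} [IsCardinalPresentable (ι.obj c) κ]
    (f : ι.obj c ⟶ s.pt) :
    ∃ (t : FilteredFactorization ι κ' c) (θ : colimit (t.D ⋙ ι) ⟶ s.pt), t.hom ≫ θ = f ∧
      ∀ e, ∃ (i : I) (g : ι.obj (t.D.obj e) ⟶ a.obj i),
        colimit.ι (t.D ⋙ ι) e ≫ θ = g ≫ s.ι.app i := by
  have := isFiltered_comma ι a
  obtain ⟨α, _, _, _, P, _⟩ := IsFiltered.exists_directed (Comma ι a)
  let D₀ : α ⥤ A := P ⋙ Comma.fst ι a ⋙ ι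
  have hc : IsColimit ((commaCocone ι s).whisker P) :=
    (Functor.Final.isColimitWhiskerEquiv P _).symm (isColimitCommaCocone ι hs)
  obtain ⟨U, g, hg⟩ := exists_directedSubset_factorization (D := D₀) hκ hc f
  -- The index poset is replaced by an equivalent category from a fixed small family, so that
  -- factorizations form a small set independent of `a`.
  obtain ⟨J, ⟨E⟩⟩ := SmallCategoryCardinalLT.exists_equivalence κ' U.1
    (U.hasCardinalLT_arrow (Cardinal.IsRegular.aleph0_le Fact.out))
  have : IsFiltered (SmallCategoryCardinalLT.categoryFamily κ' J) :=
    IsFiltered.of_equivalence E.symm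
  let pre : colimit (E.functor ⋙ U.incl ⋙ D₀) ⟶ colimit (U.incl ⋙ D₀) :=
    colimit.pre (U.incl ⋙ D₀) E.functor
  have : IsIso pre := inferInstance
  let θ₀ : colimit (U.incl ⋙ D₀) ⟶ s.pt :=
    colimit.desc (U.incl ⋙ D₀) (((commaCocone ι s).whisker P).whisker U.incl)
  refine ⟨⟨J, inferInstance, E.functor ⋙ U.incl ⋙ P ⋙ Comma.fst ι a, g ≫ inv pre⟩,
    pre ≫ θ₀, ?_, fun e ↦ ?_⟩
  · have : (g ≫ inv pre) ≫ pre ≫ θ₀ = f := by simpa using! hg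
    exact this
  · refine ⟨(P.obj (U.incl.obj (E.functor.obj e))).right,
      (P.obj (U.incl.obj (E.functor.obj e))).hom, ?_⟩
    have h₁ : colimit.ι (E.functor ⋙ U.incl ⋙ D₀) e ≫ pre =
        colimit.ι (U.incl ⋙ D₀) (E.functor.obj e) := colimit.ι_pre _ _ _
    have h₂ : colimit.ι (U.incl ⋙ D₀) (E.functor.obj e) ≫ θ₀ =
        ((commaCocone ι s).whisker P).ι.app (U.incl.obj (E.functor.obj e)) := colimit.ι_desc _ _
    exact (Category.assoc _ _ _).symm.trans ((congr_arg (· ≫ θ₀) h₁).trans h₂)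

end FilteredFactorization

/-! ### Small subfunctors preserving filtered colimits. -/

section Subfunctor

variable {A : Type u} [Category.{w} A] {F : A ⥤ Type w} (G : Subfunctor F)

/-- Injectivity of the comparison map is inherited from `F`, so only surjectivity needs checking. -/
lemma preservesColimitsOfShape_toFunctor {I : Type w} [SmallCategory I] [IsFiltered I]
    [PreservesColimitsOfShape I F]
    (h : ∀ {a : I ⥤ A} {s : Cocone a} (_ : IsColimit s) (y : F.obj s.pt) (_ : y ∈ G.obj s.pt),
      ∃ (i : I) (y' : F.obj (a.obj i)), y' ∈ G.obj (a.obj i) ∧ F.map (s.ι.app i) y' = y) :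
    PreservesColimitsOfShape I G.toFunctor where
  preservesColimit {a} := ⟨fun {s} hs ↦ ⟨Types.FilteredColimit.isColimitOf _ _
    (fun y ↦ by
      obtain ⟨i, y', hy', h⟩ := h hs y.1 y.2
      exact ⟨i, ⟨y', hy'⟩, Subtype.ext h.symm⟩)
    (fun i j x y hxy ↦ by
      obtain ⟨k, f, g, hfg⟩ := (Types.FilteredColimit.isColimit_eq_iff _
        (isColimitOfPreserves F hs)).1 (congr_arg Subtype.val hxy)
      exact ⟨k, f, g, Subtype.ext hfg⟩)⟩⟩

end Subfunctor

section Closure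

variable {C : Type w} [SmallCategory C] {A : Type u} [Category.{w} A]
  [HasFilteredColimitsOfSize.{w, w} A] (ι : C ⥤ A) (κ : Cardinal.{w})
  (F : A ⥤ Type w) [PreservesFilteredColimitsOfSize.{w, w} F]

variable {ι κ F} in
lemma FilteredFactorization.exists_lift {c : C} (t : FilteredFactorization ι κ c)
    (y : F.obj (ι.obj c)) :
    ∃ z : Σ e, F.obj (ι.obj (t.D.obj e)),
      F.map (colimit.ι (t.D ⋙ ι) z.1) z.2 = F.map t.hom y := by
  obtain ⟨e, y', h⟩ := Types.jointly_surjective_of_isColimit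
    (isColimitOfPreserves F (colimit.isColimit (t.D ⋙ ι))) (F.map t.hom y)
  exact ⟨⟨e, y'⟩, h⟩

/-- The elements of the functor `ι ⋙ F`. -/
abbrev Element : Type w := Σ c, F.obj (ι.obj c)

variable {ι κ F}

open Classical in
/-- A choice of a lift of an element along a filtered factorization. -/
noncomputable def stepElement (x : Element ι F) (t : Σ c, FilteredFactorization ι κ c) :
    Element ι F :=
  if h : t.1 = x.1 then
    ⟨_, ((h ▸ t.2 : FilteredFactorization ι κ x.1).exists_lift x.2).choose.2⟩
  -- A factorization at the wrong object does nothing, so every list of factorizations can be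
  -- applied.
  else x

lemma exists_stepElement {c : C} (t : FilteredFactorization ι κ c) (y : F.obj (ι.obj c)) :
    ∃ (e : _) (y' : F.obj (ι.obj (t.D.obj e))), stepElement ⟨c, y⟩ ⟨c, t⟩ = ⟨_, y'⟩ ∧
      F.map (colimit.ι (t.D ⋙ ι) e) y' = F.map t.hom y :=
  ⟨_, (t.exists_lift y).choose.2, by simp [stepElement], (t.exists_lift y).choose_spec⟩

/-- The subfunctor of `F` generated by the elements that are obtained from `x₀` by finitely many
lifts along filtered factorizations. -/
def closure (κ : Cardinal.{w}) (x₀ : Element ι F) : Subfunctor F where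
  obj X := {y | ∃ (l : List (Σ c, FilteredFactorization ι κ c))
    (f : ι.obj (l.foldl stepElement x₀).1 ⟶ X), F.map f (l.foldl stepElement x₀).2 = y}
  map := by
    rintro X Y g _ ⟨l, f, rfl⟩
    exact ⟨l, f ≫ g, by simp⟩

lemma mem_closure (κ : Cardinal.{w}) (x₀ : Element ι F) :
    x₀.2 ∈ (closure κ x₀).obj (ι.obj x₀.1) :=
  ⟨[], 𝟙 (ι.obj x₀.1), by
    change F.map (𝟙 (ι.obj x₀.1)) x₀.2 = x₀.2
    simp⟩

lemma mem_closure_of_step {κ : Cardinal.{w}} {x₀ : Element ι F} {l : List _} {z : Element ι F}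
    (hz : l.foldl (stepElement (κ := κ)) x₀ = z) :
    z.2 ∈ (closure κ x₀).obj (ι.obj z.1) := by
  subst hz
  exact ⟨l, 𝟙 _, by simp⟩

/-- A type which bounds the sizes of the values of the functors `closure κ x₀`. -/
abbrev ClosureBound (ι : C ⥤ A) (κ : Cardinal.{w}) : Type w :=
  List (Σ c, FilteredFactorization ι κ c) × Σ c d : C, (ι.obj c ⟶ ι.obj d)

/-- With `x₀` fixed, an element is determined by a list and a map. The bound ranges over all sources
and targets so as not to depend on `F`, `x₀` or `c`. -/
lemma exists_injective_closure (x₀ : Element ι F) (c : C) :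
    ∃ φ : (closure κ x₀).toFunctor.obj (ι.obj c) → ClosureBound ι κ, Function.Injective φ := by
  choose l f hf using fun y : (closure κ x₀).toFunctor.obj (ι.obj c) ↦ y.2
  have key (l₁ l₂ : List (Σ c, FilteredFactorization ι κ c))
      (f₁ : ι.obj (l₁.foldl stepElement x₀).1 ⟶ ι.obj c)
      (f₂ : ι.obj (l₂.foldl stepElement x₀).1 ⟶ ι.obj c)
      (h : (⟨l₁, _, _, f₁⟩ : ClosureBound ι κ) = ⟨l₂, _, _, f₂⟩) :
      F.map f₁ (l₁.foldl stepElement x₀).2 = F.map f₂ (l₂.foldl stepElement x₀).2 := by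
    obtain ⟨rfl, h₂⟩ := Prod.mk.inj h
    simp only [Sigma.mk.injEq, heq_eq_eq, true_and] at h₂
    rw [h₂]
  exact ⟨fun y ↦ ⟨l y, _, _, f y⟩, fun y₁ y₂ h ↦ Subtype.ext
    ((hf y₁).symm.trans ((key _ _ _ _ h).trans (hf y₂)))⟩

variable [ι.IsDense] [∀ X, IsFiltered (CostructuredArrow ι X)]

/-- An element over a colimit is the image under some `f` of an element reached by lifting. Factor
`f`, lift once more to a vertex of the small diagram, and push that lift to some `a.obj i`. -/
lemma preservesFilteredColimits_closure {κ κ' : Cardinal.{w}} [Fact κ.IsRegular]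
    [Fact κ'.IsRegular] (hκ : κ < κ') [∀ c, IsCardinalPresentable (ι.obj c) κ]
    (x₀ : Element ι F) :
    PreservesFilteredColimitsOfSize.{w, w} (closure κ' x₀).toFunctor where
  preserves_filtered_colimits I _ _ := by
    have : PreservesColimitsOfShape I F :=
      PreservesFilteredColimitsOfSize.preserves_filtered_colimits I
    refine preservesColimitsOfShape_toFunctor _ ?_
    rintro a s hs _ ⟨l, f, rfl⟩
    obtain ⟨t, θ, rfl, ht⟩ := exists_filteredFactorization ι hκ hs f
    obtain ⟨e, y', h₁, h₂⟩ := exists_stepElement t (l.foldl stepElement x₀).2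
    obtain ⟨i, g, hg⟩ := ht e
    refine ⟨i, F.map g y', (closure κ' x₀).map g
      (mem_closure_of_step (l := l ++ [⟨_, t⟩]) (z := ⟨_, y'⟩) ?_), ?_⟩
    · rw [List.foldl_append]
      exact h₁
    · rw [← Functor.map_comp_apply, ← hg, Functor.map_comp_apply, h₂, ← Functor.map_comp_apply]

end Closure

/-! ### Limits, colimits and evaluations in the Scott topos. -/

section

universe v₃ u₃

variable {C : Type u₁} [Category.{v₁} C] {D : Type u₂} [Category.{v₂} D]
  {J : Type u₃} [Category.{v₃} J]

lemma isIso_app_of_isLimit {Φ Ψ : C ⥤ D} (α : Φ ⟶ Ψ) [PreservesLimitsOfShape J Φ]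
    [PreservesLimitsOfShape J Ψ] {K : J ⥤ C} {c : Cone K} (hc : IsLimit c)
    [∀ j, IsIso (α.app (K.obj j))] : IsIso (α.app c.pt) := by
  have (j : J) : IsIso ((Functor.whiskerLeft K α).app j) :=
    inferInstanceAs (IsIso (α.app (K.obj j)))
  have := NatIso.isIso_of_isIso_app (Functor.whiskerLeft K α)
  let e := IsLimit.conePointsIsoOfNatIso (isLimitOfPreserves Φ hc) (isLimitOfPreserves Ψ hc)
    (asIso (Functor.whiskerLeft K α))
  have : α.app c.pt = e.hom := (isLimitOfPreserves Ψ hc).hom_ext fun j ↦ by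
    refine .trans ?_ (IsLimit.conePointsIsoOfNatIso_hom_comp (isLimitOfPreserves Φ hc)
      (isLimitOfPreserves Ψ hc) (asIso (Functor.whiskerLeft K α)) j).symm
    exact (α.naturality (c.π.app j)).symm
  rw [this]
  infer_instance

lemma isIso_app_of_isColimit {Φ Ψ : C ⥤ D} (α : Φ ⟶ Ψ) [PreservesColimitsOfShape J Φ]
    [PreservesColimitsOfShape J Ψ] {K : J ⥤ C} {c : Cocone K} (hc : IsColimit c)
    [∀ j, IsIso (α.app (K.obj j))] : IsIso (α.app c.pt) := by
  have (j : J) : IsIso ((Functor.whiskerLeft K α).app j) :=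
    inferInstanceAs (IsIso (α.app (K.obj j)))
  have := NatIso.isIso_of_isIso_app (Functor.whiskerLeft K α)
  let e := IsColimit.coconePointsIsoOfNatIso (isColimitOfPreserves Φ hc)
    (isColimitOfPreserves Ψ hc) (asIso (Functor.whiskerLeft K α))
  have : α.app c.pt = e.hom := (isColimitOfPreserves Φ hc).hom_ext fun j ↦ by
    refine .trans ?_ (IsColimit.comp_coconePointsIsoOfNatIso_hom (isColimitOfPreserves Φ hc)
      (isColimitOfPreserves Ψ hc) (asIso (Functor.whiskerLeft K α)) j).symm
    exact α.naturality (c.ι.app j)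
  rw [this]
  infer_instance

end

section Closed

variable {A : Type u} [Category.{w} A]

/-- The comparison map `colim F(a i) ⟶ F X` attached to a cocone with point `X` over a
diagram `a`, as a natural transformation of functors in `F`. -/
noncomputable def colimitComparison {I : Type w} [SmallCategory I] {a : I ⥤ A} (s : Cocone a) :
    (Functor.whiskeringLeft I A (Type w)).obj a ⋙ colim ⟶
      (evaluation A (Type w)).obj s.pt where
  app F := colimit.desc (a ⋙ F) (F.mapCocone s)
  naturality F G f := colimit.hom_ext fun i ↦ by simp

lemma preservesColimit_iff_isIso_colimitComparison {I : Type w} [SmallCategory I] {a : I ⥤ A}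
    {s : Cocone a} (hs : IsColimit s) (F : A ⥤ Type w) :
    PreservesColimit a F ↔ IsIso ((colimitComparison s).app F) := by
  constructor
  · intro
    exact ((colimit.isColimit (a ⋙ F)).coconePointUniqueUpToIso
      (isColimitOfPreserves F hs)).isIso_hom
  · intro (h : IsIso (colimit.desc (a ⋙ F) (F.mapCocone s)))
    have : IsIso ((colimit.isColimit (a ⋙ F)).desc (F.mapCocone s)) := h
    exact preservesColimit_of_preserves_colimit_cocone hs
      ((colimit.isColimit (a ⋙ F)).ofPointIso (t := F.mapCocone s))

lemma preservesDirectedColimits_iff (F : A ⥤ Type w) :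
    preservesDirectedColimits A F ↔ ∀ (I : Type w) [SmallCategory I] [IsFiltered I] (a : I ⥤ A)
      (s : Cocone a) (_ : IsColimit s), IsIso ((colimitComparison s).app F) := by
  constructor
  · intro h I _ _ a s hs
    have := h.preserves_filtered_colimits I
    exact (preservesColimit_iff_isIso_colimitComparison hs F).1 inferInstance
  · intro h
    exact ⟨fun I _ _ ↦ ⟨fun {a} ↦ ⟨fun {s} hs ↦
      ((preservesColimit_iff_isIso_colimitComparison hs F).2 (h I a s hs)).preserves hs⟩⟩⟩

/-- Both sides of `colimitComparison` preserve colimits in `F`, so the functors at which it is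
invertible are closed under them. -/
instance (J : Type*) [Category* J] [HasColimitsOfShape J (Type w)] :
    (preservesDirectedColimits A).IsClosedUnderColimitsOfShape J where
  colimitsOfShape_le := by
    rintro F ⟨h⟩
    rw [preservesDirectedColimits_iff]
    intro I _ _ a s hs
    have (j : J) : IsIso ((colimitComparison s).app (h.diag.obj j)) :=
      (preservesDirectedColimits_iff _).1 (h.prop_diag_obj j) I a s hs
    exact isIso_app_of_isColimit (colimitComparison s) h.isColimit

/-- Filteredness of `I` enters here: `colim` over `I` commutes with finite limits. -/
instance (J : Type) [SmallCategory J] [FinCategory J] :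
    (preservesDirectedColimits A).IsClosedUnderLimitsOfShape J where
  limitsOfShape_le := by
    rintro F ⟨h⟩
    rw [preservesDirectedColimits_iff]
    intro I _ _ a s hs
    have (j : J) : IsIso ((colimitComparison s).app (h.diag.obj j)) :=
      (preservesDirectedColimits_iff _).1 (h.prop_diag_obj j) I a s hs
    exact isIso_app_of_isLimit (colimitComparison s) h.isLimit

instance : HasFiniteLimits (Scott A) where
  out _ _ _ := inferInstance

instance : HasColimitsOfSize.{w, w} (Scott A) where

/-- The evaluation of the objects of the Scott topos of `A` at an object of `A`. -/
abbrev Scott.eval (X : A) : Scott A ⥤ Type w :=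
  (preservesDirectedColimits A).ι ⋙ (evaluation A (Type w)).obj X

instance (X : A) : PreservesFiniteLimits (Scott.eval X) where
  preservesFiniteLimits J _ _ := by
    unfold Scott.eval
    infer_instance

instance (X : A) : PreservesColimitsOfSize.{w, w} (Scott.eval X) where

end Closed

/-! ### Giraud's theorem up to shrinking hom-sets. -/

section LocallySmall

universe u' v' i

/-- Giraud's theorem for locally small categories with enough points. -/
theorem isGrothendieckTopos_and_hasEnoughPoints_of_locallySmall
    {E : Type u'} [Category.{v'} E] [LocallySmall.{w} E] [HasFiniteLimits E]
    [HasColimitsOfSize.{w, w} E] {I : Type i} (p : I → E ⥤ Type w)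
    [∀ i, PreservesFiniteLimits (p i)] [∀ i, PreservesColimitsOfSize.{w, w} (p i)]
    {T : Type w} (G : T → E)
    (hG : ∀ (i : I) (X : E) (x : (p i).obj X),
      ∃ (t : T) (a : G t ⟶ X) (z : (p i).obj (G t)), (p i).map a z = x)
    (hiso : ∀ ⦃X Y : E⦄ (f : X ⟶ Y), (∀ i, IsIso ((p i).map f)) → IsIso f)
    {𝒢 : Type u₁} [Category.{v₁} 𝒢] (e : 𝒢 ≌ E) :
    IsGrothendieckTopos.{w} 𝒢 ∧ HasEnoughPoints.{w} 𝒢 := by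
  let S := ShrinkHoms.equivalence.{w} E
  have : HasFiniteLimits (ShrinkHoms.{u'} E) :=
    ⟨fun _ _ _ ↦ Adjunction.hasLimitsOfShape_of_equivalence S.inverse⟩
  have : HasColimitsOfSize.{w, w} (ShrinkHoms.{u'} E) :=
    Adjunction.has_colimits_of_equivalence S.inverse
  let D := InducedCategory (ShrinkHoms.{u'} E) fun t ↦ S.functor.obj (G t)
  refine isGrothendieckTopos_and_hasEnoughPoints (D := D) (inducedFunctor _)
    (fun i ↦ S.inverse ⋙ p i) (fun i X x ↦ ?_) (fun X Y f hf ↦ ?_) (e.trans S)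
  · obtain ⟨t, a, z, h⟩ := hG i (S.inverse.obj X) x
    let a' : S.functor.obj (G t) ⟶ X := S.inverse.preimage a
    refine ⟨t, a', z, ?_⟩
    have ha : S.inverse.map a' = a := S.inverse.map_preimage (X := S.functor.obj (G t)) a
    exact (congr_arg (fun k : G t ⟶ S.inverse.obj X ↦ (p i).map k z) ha).trans h
  · have := hiso (S.inverse.map f) hf
    exact isIso_of_reflects_iso f S.inverse

end LocallySmall

/-! ### Restriction to a dense small subcategory. -/

section Restriction

variable {C : Type w} [SmallCategory C] {A : Type u} [Category.{w} A] (ι : C ⥤ A)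

/-- The restriction functor from the Scott topos of `A` to functors on `C`. -/
abbrev Scott.restriction : Scott A ⥤ C ⥤ Type w :=
  (preservesDirectedColimits A).ι ⋙ (Functor.whiskeringLeft C A (Type w)).obj ι

variable [ι.IsDense] [∀ X, IsFiltered (CostructuredArrow ι X)]

/-- By density `X` is the colimit of the objects of `C` over it; this colimit is filtered, so `G`
preserves it. -/
lemma isLeftKanExtension_of_preservesDirectedColimits (G : Scott A) :
    G.obj.IsLeftKanExtension (𝟙 (ι ⋙ G.obj)) :=
  Functor.LeftExtension.IsPointwiseLeftKanExtension.isLeftKanExtension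
    (E := Functor.LeftExtension.mk G.obj (𝟙 (ι ⋙ G.obj))) fun X ↦ by
    have := G.property.preserves_filtered_colimits (CostructuredArrow ι X)
    exact (isColimitOfPreserves G.obj (ι.denseAt X)).ofIsoColimit
      (Cocone.ext (Iso.refl _) fun Y ↦ by
        have h : (𝟙 (ι.obj Y.left) ≫ Y.hom : ι.obj Y.left ⟶ X) = Y.hom := Category.id_comp _
        exact (Category.comp_id _).trans ((congr_arg G.obj.map h).trans (Category.id_comp _).symm))

/-- The objects of the Scott topos of `A` are determined by their restrictions to a dense
subcategory. -/
noncomputable def Scott.fullyFaithfulRestriction : (Scott.restriction ι).FullyFaithful where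
  preimage {G F} φ :=
    have := isLeftKanExtension_of_preservesDirectedColimits ι G
    ObjectProperty.homMk (G.obj.descOfIsLeftKanExtension (𝟙 (ι ⋙ G.obj)) F.obj φ)
  map_preimage {G F} φ := by
    have := isLeftKanExtension_of_preservesDirectedColimits ι G
    simpa using! G.obj.descOfIsLeftKanExtension_fac (𝟙 (ι ⋙ G.obj)) F.obj φ
  preimage_map {G F} φ := by
    have := isLeftKanExtension_of_preservesDirectedColimits ι G
    ext1
    refine G.obj.hom_ext_of_isLeftKanExtension (𝟙 (ι ⋙ G.obj)) _ _ ?_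
    exact G.obj.descOfIsLeftKanExtension_fac (𝟙 (ι ⋙ G.obj)) F.obj _

lemma Scott.isIso_of_isIso_eval {F G : Scott A} (f : F ⟶ G)
    (h : ∀ c, IsIso ((Scott.eval (ι.obj c)).map f)) : IsIso f := by
  have : IsIso ((Scott.restriction ι).map f) := by
    have (c : C) : IsIso (((Scott.restriction ι).map f).app c) := h c
    exact NatIso.isIso_of_isIso_app _
  exact (Scott.fullyFaithfulRestriction ι).isIso_of_isIso_map f

include ι in
lemma Scott.locallySmall : LocallySmall.{w} (Scott A) :=
  have := (Scott.fullyFaithfulRestriction ι).faithful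
  locallySmall_of_faithful (Scott.restriction ι)

end Restriction

/-! ### Functors of bounded size form a small set up to isomorphism. -/

section BoundedFunctors

variable {C : Type w} [SmallCategory C] (K : Type w)

/-- The category of subsets of `K` and arbitrary maps. -/
abbrev SubsetCategory : Type w := InducedCategory (Type w) (fun S : Set K ↦ (S : Type w))

variable {K}

lemma exists_iso_of_injective (H : C ⥤ Type w) (φ : ∀ c, H.obj c → K)
    (hφ : ∀ c, Function.Injective (φ c)) :
    ∃ H' : C ⥤ SubsetCategory K, Nonempty (H' ⋙ inducedFunctor _ ≅ H) := by
  let e (c : C) : (Set.range (φ c) : Type w) ≅ H.obj c := (Equiv.ofInjective _ (hφ c)).symm.toIso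
  let H' : C ⥤ SubsetCategory K :=
    { obj c := Set.range (φ c)
      map {c d} f := InducedCategory.homMk ((e c).hom ≫ H.map f ≫ (e d).inv)
      map_id c := by
        rw [H.map_id, Category.id_comp, Iso.hom_inv_id]
        rfl
      map_comp f g := by
        ext1
        change (e _).hom ≫ H.map (f ≫ g) ≫ (e _).inv =
          ((e _).hom ≫ H.map f ≫ (e _).inv) ≫ (e _).hom ≫ H.map g ≫ (e _).inv
        simp }
  exact ⟨H', ⟨NatIso.ofComponents e (fun {c d} f ↦
    show ((e c).hom ≫ H.map f ≫ (e d).inv) ≫ (e d).hom = _ by simp)⟩⟩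

end BoundedFunctors

/-! ### The small generating set, and the theorem. -/

section Generators

variable {C : Type w} [SmallCategory C] {A : Type u} [Category.{w} A]
  [HasFilteredColimitsOfSize.{w, w} A] (ι : C ⥤ A)
  [ι.IsDense] [∀ X, IsFiltered (CostructuredArrow ι X)]
  (κ : Cardinal.{w}) [Fact κ.IsRegular] [∀ c, IsCardinalPresentable (ι.obj c) κ]

include κ in
lemma Scott.exists_small_generators :
    ∃ (T : Type w) (G : T → Scott A), ∀ (F : Scott A) (c : C) (x : (Scott.eval (ι.obj c)).obj F),
      ∃ (t : T) (a : G t ⟶ F) (z : (Scott.eval (ι.obj c)).obj (G t)),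
        (Scott.eval (ι.obj c)).map a z = x := by
  have hκ : κ < Order.succ κ := Order.lt_succ κ
  have : Fact (Order.succ κ).IsRegular :=
    ⟨Cardinal.isRegular_succ (Cardinal.IsRegular.aleph0_le Fact.out)⟩
  let K := ClosureBound ι (Order.succ κ)
  -- `T` is small since `C` and `SubsetCategory K` are. The object chosen for `t` is determined up
  -- to isomorphism because restriction is fully faithful.
  let T := {H : C ⥤ SubsetCategory K //
    ∃ G : Scott A, Nonempty (H ⋙ inducedFunctor _ ≅ (Scott.restriction ι).obj G)}
  refine ⟨T, fun t ↦ t.2.choose, fun F c x ↦ ?_⟩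
  have := F.property
  change PreservesFilteredColimitsOfSize.{w, w} F.obj at this
  let x₀ : Element ι F.obj := ⟨c, x⟩
  let G : Scott A := ⟨(closure (Order.succ κ) x₀).toFunctor,
    preservesFilteredColimits_closure hκ x₀⟩
  choose φ hφ using exists_injective_closure (κ := Order.succ κ) x₀
  obtain ⟨H, ⟨e⟩⟩ := exists_iso_of_injective ((Scott.restriction ι).obj G) φ hφ
  let t : T := ⟨H, G, ⟨e⟩⟩
  let e' : t.2.choose ≅ G := (Scott.fullyFaithfulRestriction ι).preimageIso
    (t.2.choose_spec.some.symm ≪≫ e)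
  let i : G ⟶ F := ObjectProperty.homMk (closure (Order.succ κ) x₀).ι
  let y : (Scott.eval (ι.obj c)).obj G := ⟨x, mem_closure (Order.succ κ) x₀⟩
  refine ⟨t, e'.hom ≫ i, (Scott.eval (ι.obj c)).map e'.inv y, ?_⟩
  rw [← Functor.map_comp_apply, Iso.inv_hom_id_assoc]
  rfl

end Generators

end ScottTopos

theorem mainTheorem4 {A : Type u} [Category.{w} A]
    [IsAccessibleCategory.{w} A] [HasFilteredColimitsOfSize.{w, w} A]
    {𝒢 : Type u₁} [Category.{v₁} 𝒢] (e : 𝒢 ≌ ScottTopos.Scott.{w} A) :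
    ScottTopos.IsGrothendieckTopos.{w} 𝒢 ∧ ScottTopos.HasEnoughPoints.{w} 𝒢 := by
  obtain ⟨κ, _, _⟩ := IsAccessibleCategory.exists_cardinal A
  let C := SmallModel.{w} (isCardinalPresentable A κ).FullSubcategory
  let ε : C ≌ (isCardinalPresentable A κ).FullSubcategory := (equivSmallModel _).symm
  let ι : C ⥤ A := ε.functor ⋙ (isCardinalPresentable A κ).ι
  have (X : A) : IsFiltered (CostructuredArrow ι X) := by
    have := isFiltered_of_isCardinalFiltered
      (CostructuredArrow (isCardinalPresentable A κ).ι X) κ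
    exact IsFiltered.of_equivalence
      (CostructuredArrow.pre ε.functor (isCardinalPresentable A κ).ι X).asEquivalence.symm
  have (c : C) : IsCardinalPresentable (ι.obj c) κ := (ε.functor.obj c).property
  have := ScottTopos.Scott.locallySmall ι
  obtain ⟨T, G, hG⟩ := ScottTopos.Scott.exists_small_generators ι κ
  exact ScottTopos.isGrothendieckTopos_and_hasEnoughPoints_of_locallySmall
    (fun c : C ↦ ScottTopos.Scott.eval (ι.obj c)) G (fun c F x ↦ hG F c x)
    (fun _ _ f hf ↦ ScottTopos.Scott.isIso_of_isIso_eval ι f hf) e
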